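/- Let $k$ be a field of characteristic $2$ and let $A$ be a differential graded $k$-algebra ($\mathbb{Z}$-graded, with differential $d$ of degree $+1$). All modules are right modules, $N[n]^j=N^{n+j}$, and morphisms of graded modules preserve degrees. Let $$P=\bigoplus_{i=1}^{a}H^*A[-p_i],\quad Q=\bigoplus_{i=1}^{b}H^*A[-q_i],\quad R=\bigoplus_{i=1}^{c}H^*A[-r_i],\quad S=\bigoplus_{i=1}^{e}H^*A[-s_i]$$ be finitely generated free graded $H^*A$-modules, and let $$S\xrightarrow{\;Z\;}R\xrightarrow{\;Y\;}Q\xrightarrow{\;X\;}P$$ be morphisms of graded $H^*A$-modules with $XY=0$ and $YZ=0$. They are identified with matrices over $H^*A$ with homogeneous entries, $|X_{ij}|=q_j-p_i$, $|Y_{ij}|=r_j-q_i$, $|Z_{ij}|=s_j-r_i$. The matric Massey product $\langle X,Y,Z\rangle$ is the set of all matrices $B$ over $H^*A$ obtained as follows: choose matrices $\bar X,\bar Y,\bar Z$ over $A$ whose entries are homogeneous cocycles (of the degrees above) representing the entries of $X,Y,Z$; choose matrices $\bar T,\bar U$ over $A$ with homogeneous entries, $|\bar T_{ij}|=r_j-p_i-1$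 and $|\bar U_{ij}|=s_j-q_i-1$, such that $\bar X\bar Y=d\bar T$ and $\bar Y\bar Z=d\bar U$ (entrywise differential); let $B$ be the matrix of cohomology classes of the entries of the matrix of cocycles $\bar T\bar Z-\bar X\bar U$. If $0\notin\langle X,Y,Z\rangle$, then the graded $H^*A$-module $C=\operatorname{coker}(X)$ is not a direct summand of $H^*M$ for any differential graded $A$-module $M$; that is, there are no morphisms of graded $H^*A$-modules $C\xrightarrow{f}H^*M\xrightarrow{g}C$ with $g\circ f=\mathrm{id}_C$. -/

import Mathlib

open scoped DirectSum

universe u v w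

/-- A differential graded algebra structure over `k` on the `ℤ`-graded algebra `A = ⨁ 𝒜 n`:
a differential of degree `+1` which satisfies the graded Leibniz rule. -/
structure DGAlgebra {k : Type u} {A : Type v} [Field k] [Ring A] [Algebra k A]
    (𝒜 : ℤ → Submodule k A) [GradedAlgebra 𝒜] where
  /-- the differential -/
  d : A →ₗ[k] A
  d_mem : ∀ {n : ℤ} {a : A}, a ∈ 𝒜 n → d a ∈ 𝒜 (n + 1)
  d_d : ∀ a : A, d (d a) = 0
  leibniz : ∀ {n : ℤ} {a : A}, a ∈ 𝒜 n → ∀ b : A, d (a * b) = d a * b + n.negOnePow • (a * d b)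

/-- A differential graded right module structure over the dg-algebra `(A, D)` on the graded
`k`-module `M = ⨁ ℳ n`. The right action of `a : A` on `m : M` is written `MulOpposite.op a • m`. -/
structure DGModule {k : Type u} {A : Type v} [Field k] [Ring A] [Algebra k A]
    {𝒜 : ℤ → Submodule k A} [GradedAlgebra 𝒜] (D : DGAlgebra 𝒜)
    {M : Type w} [AddCommGroup M] [Module k M] [Module Aᵐᵒᵖ M] [IsScalarTower k Aᵐᵒᵖ M]
    (ℳ : ℤ → Submodule k M) [DirectSum.Decomposition ℳ] where
  /-- the differential -/
  d : M →ₗ[k] M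
  d_mem : ∀ {n : ℤ} {m : M}, m ∈ ℳ n → d m ∈ ℳ (n + 1)
  d_d : ∀ m : M, d (d m) = 0
  smul_mem : ∀ {i j : ℤ} {m : M} {a : A}, m ∈ ℳ i → a ∈ 𝒜 j → MulOpposite.op a • m ∈ ℳ (i + j)
  leibniz : ∀ {n : ℤ} {m : M}, m ∈ ℳ n → ∀ a : A,
    d (MulOpposite.op a • m) = MulOpposite.op a • d m + n.negOnePow • (MulOpposite.op (D.d a) • m)

section

variable {k : Type u} {A : Type v} [Field k] [Ring A] [Algebra k A]
  {𝒜 : ℤ → Submodule k A} [GradedAlgebra 𝒜] {D : DGAlgebra 𝒜}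
  {M : Type w} [AddCommGroup M] [Module k M] [Module Aᵐᵒᵖ M] [IsScalarTower k Aᵐᵒᵖ M]
  {ℳ : ℤ → Submodule k M} [DirectSum.Decomposition ℳ]

namespace DGModule

variable (E : DGModule D ℳ)

theorem d_component (m : M) (i : ℤ) :
    E.d (DirectSum.decompose ℳ m i : M) = (DirectSum.decompose ℳ (E.d m) (i + 1) : M) := by
  induction m using DirectSum.Decomposition.inductionOn ℳ with
  | zero => simp
  | @homogeneous j m =>
    by_cases h : j = i
    · subst h
      rw [DirectSum.decompose_of_mem_same ℳ m.2,
        DirectSum.decompose_of_mem_same ℳ (E.d_mem m.2)]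
    · rw [DirectSum.decompose_of_mem_ne ℳ m.2 h,
        DirectSum.decompose_of_mem_ne ℳ (E.d_mem m.2) (by omega), map_zero]
  | add m m' h h' =>
    simp only [DirectSum.decompose_add, DirectSum.add_apply, Submodule.coe_add, map_add, h, h']

theorem d_smul_cocycle (m : M) {a : A} (ha : D.d a = 0) :
    E.d (MulOpposite.op a • m) = MulOpposite.op a • E.d m := by
  induction m using DirectSum.Decomposition.inductionOn ℳ with
  | zero => simp
  | homogeneous m => rw [E.leibniz m.2, ha]; simp
  | add m m' h h' => simp only [smul_add, map_add, h, h']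

theorem cocycle_smul_mem_range {m : M} (hm : E.d m = 0) (a : A) :
    MulOpposite.op (D.d a) • m ∈ LinearMap.range E.d := by
  classical
  rw [← DirectSum.sum_support_decompose ℳ m, Finset.smul_sum]
  refine Submodule.sum_mem _ fun i _ => ?_
  have h0 : E.d (DirectSum.decompose ℳ m i : M) = 0 := by
    rw [E.d_component, hm]; simp
  refine ⟨i.negOnePow • (MulOpposite.op a • (DirectSum.decompose ℳ m i : M)), ?_⟩
  have h1 := E.leibniz (DirectSum.decompose ℳ m i).2 a
  rw [h0, smul_zero, zero_add] at h1
  rw [Units.smul_def, map_zsmul, h1, ← Units.smul_def, smul_smul]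
  simp

/-- The cocycles of a dg-module. -/
abbrev cocycles : Submodule k M := LinearMap.ker E.d

/-- The coboundaries, as a submodule of the cocycles. -/
abbrev coboundaries : Submodule k E.cocycles := (LinearMap.range E.d).submoduleOf E.cocycles

/-- The cohomology `H^*M` of a dg-module. -/
abbrev Cohomology : Type w := E.cocycles ⧸ E.coboundaries

/-- The homogeneous part `H^nM`: the classes of the cocycles of degree `n`. -/
def cohomologyGrading (n : ℤ) : Submodule k E.Cohomology :=
  ((ℳ n).submoduleOf E.cocycles).map E.coboundaries.mkQ

end DGModule

namespace DGAlgebra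

variable (D)

/-- A dg-algebra as a right dg-module over itself. -/
def self : DGModule D 𝒜 where
  d := D.d
  d_mem := D.d_mem
  d_d := D.d_d
  smul_mem hm ha := SetLike.mul_mem_graded hm ha
  leibniz hm a := D.leibniz hm a

/-- The cocycles of a dg-algebra form a subalgebra. -/
def cocycles : Subalgebra k A where
  carrier := {a | D.d a = 0}
  mul_mem' {a b} ha hb := by
    have h := D.self.d_smul_cocycle a (a := b) hb
    have ha' : D.self.d a = 0 := ha
    rw [ha', smul_zero] at h
    exact h
  add_mem' {a b} ha hb := by
    have ha' : D.d a = 0 := ha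
    have hb' : D.d b = 0 := hb
    change D.d (a + b) = 0
    rw [map_add, ha', hb', add_zero]
  algebraMap_mem' r := by
    have h := D.leibniz (SetLike.GradedOne.one_mem (A := 𝒜)) 1
    have h1 : D.d 1 = 0 := by simpa using h
    change D.d (algebraMap k A r) = 0
    rw [Algebra.algebraMap_eq_smul_one, map_smul, h1, smul_zero]

/-- The coboundaries of a dg-algebra, as a (two-sided) ideal of the algebra of cocycles. -/
def coboundaries : Ideal D.cocycles where
  carrier := {z | (z : A) ∈ LinearMap.range D.d}
  add_mem' ha hb := Submodule.add_mem (LinearMap.range D.d) ha hb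
  zero_mem' := Submodule.zero_mem (LinearMap.range D.d)
  smul_mem' c z hz := by
    obtain ⟨a, ha⟩ := hz
    change (c : A) * (z : A) ∈ LinearMap.range D.d
    rw [← ha]
    exact D.self.cocycle_smul_mem_range c.2 a

instance : D.coboundaries.IsTwoSided where
  mul_mem_of_left {z} c hz := by
    obtain ⟨a, ha⟩ := hz
    refine ⟨a * (c : A), ?_⟩
    change D.d (a * c) = (z : A) * (c : A)
    rw [← ha]
    exact D.self.d_smul_cocycle a c.2

/-- The cohomology algebra `H^*A` of a dg-algebra. -/
abbrev Cohomology : Type v := D.cocycles ⧸ D.coboundaries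

/-- The homogeneous part `H^nA`: the classes of the cocycles of degree `n`. -/
def cohomologyGrading (n : ℤ) : Submodule k D.Cohomology :=
  ((𝒜 n).comap D.cocycles.val.toLinearMap).map
    (Ideal.Quotient.mkₐ k D.coboundaries).toLinearMap

/-- The element `a` of `A` is a cocycle with cohomology class `x`. -/
def Represents (a : A) (x : D.Cohomology) : Prop :=
  ∃ z : D.cocycles, (z : A) = a ∧ Ideal.Quotient.mk D.coboundaries z = x

end DGAlgebra

namespace DGModule

variable (E : DGModule D ℳ)

/-- The right action of cocycles of `A` on cocycles of `M`. -/
def cocycleSMul (z : D.cocycles) (m : E.cocycles) : E.cocycles :=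
  ⟨MulOpposite.op (z : A) • (m : M), by
    have hm : E.d (m : M) = 0 := m.2
    change E.d (MulOpposite.op (z : A) • (m : M)) = 0
    rw [E.d_smul_cocycle _ z.2, hm, smul_zero]⟩

/-- The right action of `H^*A` on `H^*M`, `[m] • [z] = [m • z]`. -/
instance : SMul D.Cohomologyᵐᵒᵖ E.Cohomology where
  smul x y := Quotient.map₂ E.cocycleSMul (by
    intro z z' hz m m' hm
    replace hz := (Submodule.quotientRel_def D.coboundaries).mp hz
    replace hm := (Submodule.quotientRel_def E.coboundaries).mp hm
    refine (Submodule.quotientRel_def E.coboundaries).mpr ?_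
    obtain ⟨a, ha⟩ : ((z - z' : D.cocycles) : A) ∈ LinearMap.range D.d := hz
    obtain ⟨n, hn⟩ : ((m - m' : E.cocycles) : M) ∈ LinearMap.range E.d := hm
    change MulOpposite.op (z : A) • (m : M) - MulOpposite.op (z' : A) • (m' : M) ∈
      LinearMap.range E.d
    have e : MulOpposite.op (z : A) • (m : M) - MulOpposite.op (z' : A) • (m' : M) =
        MulOpposite.op (D.d a) • (m : M) + E.d (MulOpposite.op (z' : A) • n) := by
      rw [E.d_smul_cocycle _ z'.2, ha, hn]
      push_cast
      rw [MulOpposite.op_sub, sub_smul, smul_sub]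
      abel
    rw [e]
    exact Submodule.add_mem _ (E.cocycle_smul_mem_range m.2 a) ⟨_, rfl⟩) x.unop y

theorem op_mk_smul_mk (z : D.cocycles) (m : E.cocycles) :
    MulOpposite.op (Ideal.Quotient.mk D.coboundaries z) • E.coboundaries.mkQ m =
      E.coboundaries.mkQ (E.cocycleSMul z m) := rfl

/-- `H^*M` is a right module over `H^*A`. -/
instance : Module D.Cohomologyᵐᵒᵖ E.Cohomology where
  one_smul := by
    rintro ⟨m⟩
    exact congrArg E.coboundaries.mkQ (Subtype.ext (one_smul Aᵐᵒᵖ (m : M)))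
  mul_smul := by
    rintro ⟨⟨x⟩⟩ ⟨⟨y⟩⟩ ⟨m⟩
    exact congrArg E.coboundaries.mkQ
      (Subtype.ext (mul_smul (MulOpposite.op (x : A)) (MulOpposite.op (y : A)) (m : M)))
  smul_zero := by
    rintro ⟨⟨x⟩⟩
    exact congrArg E.coboundaries.mkQ (Subtype.ext (smul_zero (MulOpposite.op (x : A))))
  smul_add := by
    rintro ⟨⟨x⟩⟩ ⟨m⟩ ⟨n⟩
    exact congrArg E.coboundaries.mkQ
      (Subtype.ext (smul_add (MulOpposite.op (x : A)) (m : M) (n : M)))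
  add_smul := by
    rintro ⟨⟨x⟩⟩ ⟨⟨y⟩⟩ ⟨m⟩
    exact congrArg E.coboundaries.mkQ
      (Subtype.ext (add_smul (MulOpposite.op (x : A)) (MulOpposite.op (y : A)) (m : M)))
  zero_smul := by
    rintro ⟨m⟩
    exact congrArg E.coboundaries.mkQ (Subtype.ext (zero_smul Aᵐᵒᵖ (m : M)))

end DGModule

namespace DGAlgebra

variable (D) {ι κ l o : Type*}

/-- For `p : ι → ℤ` the free graded right `H^*A`-module `P = ⨁ᵢ H^*A[-p i]` has the underlying
module `ι → H^*A`; its part of degree `n` consists of the `v` with `v i ∈ H^{n - p i}A`. -/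
def freeGrading (p : ι → ℤ) (n : ℤ) : Submodule k (ι → D.Cohomology) :=
  Submodule.pi Set.univ fun i => D.cohomologyGrading (n - p i)

/-- The matrix `X` is a morphism of graded modules from `⨁ⱼ H^*A[-q j]` to `⨁ᵢ H^*A[-p i]`:
its entries are homogeneous with `|X i j| = q j - p i`. -/
def IsGradedMatrix (q : κ → ℤ) (p : ι → ℤ) (X : Matrix ι κ D.Cohomology) : Prop :=
  ∀ i j, X i j ∈ D.cohomologyGrading (q j - p i)

/-- The map of free right `H^*A`-modules `v ↦ X v` given by a matrix `X`. -/
def matrixMap [Fintype κ] (X : Matrix ι κ D.Cohomology) :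
    (κ → D.Cohomology) →ₗ[D.Cohomologyᵐᵒᵖ] (ι → D.Cohomology) where
  toFun v := X.mulVec v
  map_add' v w := X.mulVec_add v w
  map_smul' c v := by
    ext i
    simp [Matrix.mulVec, dotProduct, Finset.sum_mul, mul_assoc]

/-- The cokernel of the map of free right `H^*A`-modules given by `X`. -/
abbrev Coker [Fintype κ] (X : Matrix ι κ D.Cohomology) : Type _ :=
  (ι → D.Cohomology) ⧸ LinearMap.range (D.matrixMap X)

/-- The part of degree `n` of the cokernel of a map into `⨁ᵢ H^*A[-p i]`. -/
def cokerGrading [Fintype κ] (p : ι → ℤ) (X : Matrix ι κ D.Cohomology) (n : ℤ) :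
    AddSubgroup (D.Coker X) :=
  (D.freeGrading p n).toAddSubgroup.map
    (LinearMap.range (D.matrixMap X)).mkQ.toAddMonoidHom

/-- The matrix `Xb` over `A` represents the graded matrix `X` over `H^*A`: the entries of `Xb`
are cocycles of the right degrees, whose classes are the entries of `X`. -/
def RepresentsMatrix (q : κ → ℤ) (p : ι → ℤ) (Xb : Matrix ι κ A)
    (X : Matrix ι κ D.Cohomology) : Prop :=
  ∀ i j, Xb i j ∈ 𝒜 (q j - p i) ∧ D.Represents (Xb i j) (X i j)

/-- The matric Massey product `⟨X, Y, Z⟩` (in characteristic two) of graded matrices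
`S --Z--> R --Y--> Q --X--> P`, where `P = ⨁ H^*A[-p i]` and so on. It is the set of the
classes of the matrices `T Z - X U`, for all choices of representatives of `X`, `Y`, `Z` and of
`T`, `U` with `X Y = d T` and `Y Z = d U`. The entries of `T`, `U` and of the elements of the
product have degrees lowered by one. -/
def matricMassey [Fintype κ] [Fintype l] (p : ι → ℤ) (q : κ → ℤ) (r : l → ℤ) (s : o → ℤ)
    (X : Matrix ι κ D.Cohomology) (Y : Matrix κ l D.Cohomology) (Z : Matrix l o D.Cohomology) :
    Set (Matrix ι o D.Cohomology) :=
  {B | ∃ (Xb : Matrix ι κ A) (Yb : Matrix κ l A) (Zb : Matrix l o A)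
      (T : Matrix ι l A) (U : Matrix κ o A),
    D.RepresentsMatrix q p Xb X ∧ D.RepresentsMatrix r q Yb Y ∧ D.RepresentsMatrix s r Zb Z ∧
    (∀ i j, T i j ∈ 𝒜 (r j - p i - 1)) ∧ Xb * Yb = T.map D.d ∧
    (∀ i j, U i j ∈ 𝒜 (s j - q i - 1)) ∧ Yb * Zb = U.map D.d ∧
    ∀ i j, D.Represents ((T * Zb - Xb * U) i j) (B i j)}

/-- The graded right `H^*A`-module `coker X` is a direct summand of the graded right
`H^*A`-module `H^*M`: there are degree-preserving `H^*A`-linear maps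
`coker X --f--> H^*M --g--> coker X` with `g ∘ f = id`. -/
def CokerIsSummand [Fintype κ] (p : ι → ℤ) (X : Matrix ι κ D.Cohomology) (E : DGModule D ℳ) : Prop :=
  ∃ (f : D.Coker X →ₗ[D.Cohomologyᵐᵒᵖ] E.Cohomology)
    (g : E.Cohomology →ₗ[D.Cohomologyᵐᵒᵖ] D.Coker X),
    (∀ n, ∀ c ∈ D.cokerGrading p X n, f c ∈ E.cohomologyGrading n) ∧
    (∀ n, ∀ y ∈ E.cohomologyGrading n, g y ∈ D.cokerGrading p X n) ∧
    g ∘ₗ f = LinearMap.id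

end DGAlgebra

end

section

variable {k : Type u} {A : Type v} [Field k] [Ring A] [Algebra k A]
  {𝒜 : ℤ → Submodule k A} [GradedAlgebra 𝒜] {D : DGAlgebra 𝒜}
  {M : Type w} [AddCommGroup M] [Module k M] [Module Aᵐᵒᵖ M] [IsScalarTower k Aᵐᵒᵖ M]
  {ℳ : ℤ → Submodule k M} [DirectSum.Decomposition ℳ]

open MulOpposite

/-! Suppose `g ∘ f = id` on `C = coker X`; the splitting is used to make the Massey product vanish.
Let bars denote representatives over `A`, and let the row `m` consist of cocycles representing the
images under `f` of the generators of `C`. The columns of `X` vanish in `C`, so `m X̄ = d n` for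
some row `n`. If `X̄ Ȳ = d T`, then `n Ȳ + m T` is a cocycle (`DGModule.d_add_sum_smul_eq_zero`).
Lifting the value of `g` on its class to a column of cocycles and subtracting that column from `T`,
one may assume that `g` kills the class `ω` of `n Ȳ + m T`.

If `Ȳ Z̄ = d U`, then `d (n U) = m X̄ U + n Ȳ Z̄`, so `m (T Z̄ - X̄ U)` and `(n Ȳ + m T) Z̄` are
cohomologous (`DGModule.sum_smul_sub_mem_range`). With `β` the class of a column of `T Z̄ - X̄ U`,
applying `g` shows that `β` is zero in `C`, hence `β = X w`. Absorbing a representative of `w` into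
`U` gives `0 ∈ ⟨X, Y, Z⟩`. -/

theorem neg_eq_self_of_charTwo_module (k : Type u) [Field k] [CharP k 2] {M : Type w}
    [AddCommGroup M] [Module k M] (x : M) : -x = x := by
  rw [← neg_one_smul k x, CharTwo.neg_eq, one_smul]

theorem negOnePow_smul_of_charTwo_module (k : Type u) [Field k] [CharP k 2] {M : Type w}
    [AddCommGroup M] [Module k M] (n : ℤ) (x : M) : n.negOnePow • x = x := by
  rcases Int.even_or_odd n with h | h
  · rw [Int.negOnePow_even n h, one_smul]
  · rw [Int.negOnePow_odd n h, Units.neg_smul, one_smul, neg_eq_self_of_charTwo_module k]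

/-! ### Representing classes in the cohomology of a dg-module. -/

namespace DGModule

variable (E : DGModule D ℳ)

/-- In characteristic two, the Leibniz rule has no signs and holds for all elements. -/
theorem d_smul_of_charTwo [CharP k 2] (m : M) (a : A) :
    E.d (op a • m) = op a • E.d m + op (D.d a) • m := by
  induction m using DirectSum.Decomposition.inductionOn ℳ with
  | zero => simp
  | homogeneous m => rw [E.leibniz m.2, negOnePow_smul_of_charTwo_module k]
  | add m m' h h' => simp only [smul_add, map_add, h, h']; abel

/-- The differential commutes with taking components up to a shift, so the component of degree `n -
1` of any primitive is again a primitive. -/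
theorem exists_homogeneous_primitive {n : ℤ} {m : M} (hm : m ∈ ℳ n)
    (h : m ∈ LinearMap.range E.d) : ∃ m' ∈ ℳ (n - 1), E.d m' = m := by
  obtain ⟨t, rfl⟩ := h
  refine ⟨DirectSum.decompose ℳ t (n - 1), SetLike.coe_mem _, ?_⟩
  rw [E.d_component, sub_add_cancel, DirectSum.decompose_of_mem_same ℳ hm]

/-- The element `m` of `M` is a cocycle with cohomology class `y`. -/
def Represents (m : M) (y : E.Cohomology) : Prop :=
  ∃ z : E.cocycles, (z : M) = m ∧ E.coboundaries.mkQ z = y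

variable {E}

theorem represents_of_mem_cohomologyGrading {n : ℤ} {y : E.Cohomology}
    (hy : y ∈ E.cohomologyGrading n) : ∃ m ∈ ℳ n, E.Represents m y := by
  obtain ⟨z, hz, rfl⟩ := hy
  exact ⟨z, hz, z, rfl, rfl⟩

namespace Represents

variable {m m' : M} {y y' : E.Cohomology}

theorem d_eq_zero (h : E.Represents m y) : E.d m = 0 := by
  obtain ⟨z, rfl, -⟩ := h
  exact z.2

theorem add (h : E.Represents m y) (h' : E.Represents m' y') :
    E.Represents (m + m') (y + y') := by
  obtain ⟨z, rfl, rfl⟩ := h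
  obtain ⟨z', rfl, rfl⟩ := h'
  exact ⟨z + z', rfl, map_add _ _ _⟩

theorem sub (h : E.Represents m y) (h' : E.Represents m' y') :
    E.Represents (m - m') (y - y') := by
  obtain ⟨z, rfl, rfl⟩ := h
  obtain ⟨z', rfl, rfl⟩ := h'
  exact ⟨z - z', rfl, map_sub _ _ _⟩

theorem zero_iff : E.Represents m 0 ↔ m ∈ LinearMap.range E.d := by
  constructor
  · rintro ⟨z, rfl, hz⟩
    exact (Submodule.Quotient.mk_eq_zero E.coboundaries).mp hz
  · rintro ⟨t, rfl⟩
    exact ⟨⟨E.d t, E.d_d t⟩, rfl, (Submodule.Quotient.mk_eq_zero _).mpr ⟨t, rfl⟩⟩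

theorem sum {ι : Type*} (t : Finset ι) {m : ι → M} {y : ι → E.Cohomology}
    (h : ∀ i, E.Represents (m i) (y i)) : E.Represents (∑ i ∈ t, m i) (∑ i ∈ t, y i) := by
  classical
  induction t using Finset.induction_on with
  | empty => simpa using zero_iff.mpr (Submodule.zero_mem _)
  | insert i t hi ih => rw [Finset.sum_insert hi, Finset.sum_insert hi]; exact (h i).add ih

theorem smul {a : A} {x : D.Cohomology} (ha : D.Represents a x) (h : E.Represents m y) :
    E.Represents (op a • m) (op x • y) := by
  obtain ⟨z, rfl, rfl⟩ := h
  obtain ⟨c, rfl, rfl⟩ := ha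
  exact ⟨E.cocycleSMul c z, rfl, rfl⟩

theorem eq_of_sub_mem_range (h : E.Represents m y) (h' : E.Represents m' y')
    (hm : m - m' ∈ LinearMap.range E.d) : y = y' := by
  obtain ⟨z, rfl, rfl⟩ := h
  obtain ⟨z', rfl, rfl⟩ := h'
  exact (Submodule.Quotient.eq _).mpr hm

end Represents

end DGModule

/-! ### Representing classes and matrices over the cohomology algebra. -/

namespace DGAlgebra

theorem d_mul_of_charTwo [CharP k 2] (a b : A) : D.d (a * b) = D.d a * b + a * D.d b :=
  D.self.d_smul_of_charTwo a b

theorem exists_homogeneous_primitive {n : ℤ} {a : A} (ha : a ∈ 𝒜 n)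
    (h : a ∈ LinearMap.range D.d) : ∃ t ∈ 𝒜 (n - 1), D.d t = a :=
  D.self.exists_homogeneous_primitive ha h

theorem exists_represents {a : A} (ha : D.d a = 0) : ∃ x, D.Represents a x :=
  ⟨_, ⟨a, ha⟩, rfl, rfl⟩

theorem represents_surjective (x : D.Cohomology) : ∃ a, D.Represents a x := by
  obtain ⟨z, rfl⟩ := Ideal.Quotient.mk_surjective x
  exact ⟨z, z, rfl, rfl⟩

theorem represents_of_mem_cohomologyGrading {n : ℤ} {x : D.Cohomology}
    (hx : x ∈ D.cohomologyGrading n) : ∃ a ∈ 𝒜 n, D.Represents a x := by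
  obtain ⟨z, hz, rfl⟩ := hx
  exact ⟨z, hz, z, rfl, rfl⟩

theorem one_mem_cohomologyGrading : (1 : D.Cohomology) ∈ D.cohomologyGrading 0 :=
  ⟨1, SetLike.GradedOne.one_mem (A := 𝒜), map_one (Ideal.Quotient.mkₐ k D.coboundaries)⟩

theorem IsGradedMatrix.exists_representsMatrix {ι κ : Type*} {q : κ → ℤ} {p : ι → ℤ}
    {X : Matrix ι κ D.Cohomology} (hX : D.IsGradedMatrix q p X) :
    ∃ Xb, D.RepresentsMatrix q p Xb X := by
  choose Xb h using fun i j => represents_of_mem_cohomologyGrading (hX i j)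
  exact ⟨Xb, h⟩

namespace Represents

variable {a a' : A} {x x' : D.Cohomology}

theorem d_eq_zero (h : D.Represents a x) : D.d a = 0 := by
  obtain ⟨z, rfl, -⟩ := h
  exact z.2

theorem add (h : D.Represents a x) (h' : D.Represents a' x') :
    D.Represents (a + a') (x + x') := by
  obtain ⟨z, rfl, rfl⟩ := h
  obtain ⟨z', rfl, rfl⟩ := h'
  exact ⟨z + z', rfl, map_add _ _ _⟩

theorem sub (h : D.Represents a x) (h' : D.Represents a' x') :
    D.Represents (a - a') (x - x') := by
  obtain ⟨z, rfl, rfl⟩ := h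
  obtain ⟨z', rfl, rfl⟩ := h'
  exact ⟨z - z', rfl, map_sub _ _ _⟩

theorem mul (h : D.Represents a x) (h' : D.Represents a' x') :
    D.Represents (a * a') (x * x') := by
  obtain ⟨z, rfl, rfl⟩ := h
  obtain ⟨z', rfl, rfl⟩ := h'
  exact ⟨z * z', rfl, map_mul _ _ _⟩

theorem zero_iff : D.Represents a 0 ↔ a ∈ LinearMap.range D.d := by
  constructor
  · rintro ⟨z, rfl, hz⟩
    exact Ideal.Quotient.eq_zero_iff_mem.mp hz
  · rintro ⟨t, rfl⟩
    exact ⟨⟨D.d t, D.d_d t⟩, rfl, Ideal.Quotient.eq_zero_iff_mem.mpr ⟨t, rfl⟩⟩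

theorem sum {ι : Type*} (t : Finset ι) {a : ι → A} {x : ι → D.Cohomology}
    (h : ∀ i, D.Represents (a i) (x i)) : D.Represents (∑ i ∈ t, a i) (∑ i ∈ t, x i) := by
  classical
  induction t using Finset.induction_on with
  | empty => simpa using zero_iff.mpr (Submodule.zero_mem _)
  | insert i t hi ih => rw [Finset.sum_insert hi, Finset.sum_insert hi]; exact (h i).add ih

end Represents

variable {ι κ l : Type*} [Fintype κ] {p : ι → ℤ} {q : κ → ℤ} {r : l → ℤ}
  {X : Matrix ι κ D.Cohomology} {Y : Matrix κ l D.Cohomology}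

theorem mul_apply_mem {Xb : Matrix ι κ A} {Yb : Matrix κ l A} {u v n : ℤ} {i : ι} {j : l}
    (hX : ∀ k, Xb i k ∈ 𝒜 (q k - u)) (hY : ∀ k, Yb k j ∈ 𝒜 (v - q k)) (hn : n = v - u) :
    (Xb * Yb) i j ∈ 𝒜 n := by
  subst hn
  refine Submodule.sum_mem _ fun k _ => ?_
  have := SetLike.mul_mem_graded (hX k) (hY k)
  rwa [show q k - u + (v - q k) = v - u by ring] at this

/-- Representatives of matrices with zero product multiply to the differential of a homogeneous
matrix. -/
theorem exists_matrix_primitive {Xb : Matrix ι κ A} {Yb : Matrix κ l A}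
    (hXb : D.RepresentsMatrix q p Xb X) (hYb : D.RepresentsMatrix r q Yb Y) (hXY : X * Y = 0) :
    ∃ T : Matrix ι l A, (∀ i j, T i j ∈ 𝒜 (r j - p i - 1)) ∧ Xb * Yb = T.map D.d := by
  have h (i j) : ∃ t ∈ 𝒜 (r j - p i - 1), D.d t = (Xb * Yb) i j := by
    refine exists_homogeneous_primitive
      (mul_apply_mem (fun k => (hXb i k).1) (fun k => (hYb k j).1) rfl) ?_
    rw [← Represents.zero_iff, ← Matrix.zero_apply (α := D.Cohomology) i j, ← hXY,
      Matrix.mul_apply, Matrix.mul_apply]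
    exact Represents.sum _ fun k => (hXb i k).2.mul (hYb k j).2
  choose T hT hd using h
  exact ⟨T, hT, by ext i j; exact (hd i j).symm⟩

/-- If a homogeneous column of cocycles represents an element of the image of `X`, then up to
coboundaries it is the product of a representative of `X` with a homogeneous column of cocycles. -/
theorem exists_homogeneous_preimage {Xb : Matrix ι κ A} (hXb : D.RepresentsMatrix q p Xb X)
    {n : ℤ} {b : ι → A} (hb : ∀ i, b i ∈ 𝒜 (n - p i)) {β : ι → D.Cohomology}
    (hβ : ∀ i, D.Represents (b i) (β i)) (h : β ∈ LinearMap.range (D.matrixMap X)) :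
    ∃ v : κ → A, (∀ j, v j ∈ 𝒜 (n - q j)) ∧ (∀ j, D.d (v j) = 0) ∧
      ∀ i, b i - ∑ j, Xb i j * v j ∈ LinearMap.range D.d := by
  obtain ⟨y, rfl⟩ := h
  choose c hc using fun j => represents_surjective (y j)
  -- The lifts `c j` need not be homogeneous. Since `Xb i j` is, the component of degree `n - p i`
  -- of `b i - ∑ j, Xb i j * c j = d t` involves only the components of `c j` of degree `n - q j`.
  refine ⟨fun j => DirectSum.decompose 𝒜 (c j) (n - q j), fun j => SetLike.coe_mem _,
    fun j => ?_, fun i => ?_⟩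
  · have := D.self.d_component (c j) (n - q j)
    change D.d _ = (DirectSum.decompose 𝒜 (D.d (c j)) (n - q j + 1) : A) at this
    rw [this, (hc j).d_eq_zero]
    simp
  · have h1 : D.Represents (b i - ∑ j, Xb i j * c j) 0 := by
      have := (hβ i).sub (Represents.sum Finset.univ fun j => (hXb i j).2.mul (hc j))
      convert this using 1
      exact (sub_self _).symm
    obtain ⟨t, ht⟩ := Represents.zero_iff.mp h1
    refine ⟨DirectSum.decompose 𝒜 t (n - p i - 1), ?_⟩
    refine (D.self.d_component t (n - p i - 1)).trans ?_
    change (DirectSum.decompose 𝒜 (D.d t) (n - p i - 1 + 1) : A) = _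
    rw [ht, sub_add_cancel, DirectSum.decompose_sub, DirectSum.decompose_sum,
      DirectSum.sub_apply, DirectSum.sum_apply]
    push_cast
    rw [DirectSum.decompose_of_mem_same 𝒜 (hb i)]
    congr 1
    refine Finset.sum_congr rfl fun j _ => ?_
    rw [show n - p i = (q j - p i) + (n - q j) by ring]
    exact DirectSum.coe_decompose_mul_add_of_left_mem 𝒜 (hXb i j).1

variable [DecidableEq ι]

theorem single_one_mem_freeGrading (p : ι → ℤ) (i : ι) :
    (Pi.single i 1 : ι → D.Cohomology) ∈ D.freeGrading p (p i) := by
  intro j _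
  by_cases h : j = i
  · subst h
    simpa using one_mem_cohomologyGrading
  · simp [h]

/-- A linear map out of the cokernel is computed on representatives by the images of the
generators. -/
theorem represents_map_mkQ [Fintype ι] {E : DGModule D ℳ} (f : D.Coker X →ₗ[D.Cohomologyᵐᵒᵖ] E.Cohomology)
    {m : ι → M}
    (hm : ∀ i, E.Represents (m i) (f ((LinearMap.range (D.matrixMap X)).mkQ (Pi.single i 1))))
    {b : ι → A} {β : ι → D.Cohomology} (hb : ∀ i, D.Represents (b i) (β i)) :
    E.Represents (∑ i, op (b i) • m i) (f ((LinearMap.range (D.matrixMap X)).mkQ β)) := by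
  have : β = ∑ i, op (β i) • (Pi.single i 1 : ι → D.Cohomology) := by
    ext j
    simp [Finset.sum_apply, Pi.single_apply]
  rw [this, map_sum, map_sum]
  refine DGModule.Represents.sum _ fun i => ?_
  rw [map_smul, map_smul]
  exact (hm i).smul (hb i)

end DGAlgebra

/-! ### Rows of elements of a dg-module multiplied by matrices over the algebra. -/

theorem op_mul_sum_smul {ι κ l : Type*} [Fintype ι] [Fintype κ] (m : ι → M)
    (P : Matrix ι κ A) (Q : Matrix κ l A) (j : l) :
    ∑ i, op ((P * Q) i j) • m i = ∑ k, op (Q k j) • ∑ i, op (P i k) • m i := by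
  simp only [Matrix.mul_apply, Finset.smul_sum, smul_smul, ← op_mul, Finset.op_sum,
    Finset.sum_smul]
  exact Finset.sum_comm

namespace DGModule

variable {ι κ l o : Type*} [Fintype ι]

/-- The shift `n'` is `0` for the cocycles representing generators and `1` for the primitives, whose
degree is one lower. -/
theorem sum_smul_mem (E : DGModule D ℳ) {m : ι → M} {p : ι → ℤ} {b : ι → A} {n n' : ℤ} (hm : ∀ i, m i ∈ ℳ (p i - n'))
    (hb : ∀ i, b i ∈ 𝒜 (n + n' - p i)) : ∑ i, op (b i) • m i ∈ ℳ n := by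
  refine Submodule.sum_mem _ fun i _ => ?_
  have := E.smul_mem (hm i) (hb i)
  rwa [show p i - n' + (n + n' - p i) = n by ring] at this

variable (E : DGModule D ℳ) [Fintype κ]

/-- Both `n Q` and `m T` have differential `m P Q`, and the two copies cancel in characteristic two.
-/
theorem d_add_sum_smul_eq_zero [CharP k 2] {m : ι → M} {n : κ → M} {P : Matrix ι κ A}
    {Q : Matrix κ l A} {T : Matrix ι l A} (hm : ∀ i, E.d (m i) = 0)
    (hn : ∀ j, E.d (n j) = ∑ i, op (P i j) • m i) (hQ : ∀ i j, D.d (Q i j) = 0)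
    (hT : P * Q = T.map D.d) (j : l) :
    E.d (∑ k, op (Q k j) • n k + ∑ i, op (T i j) • m i) = 0 := by
  have h1 : E.d (∑ k, op (Q k j) • n k) = ∑ i, op ((P * Q) i j) • m i := by
    simp only [map_sum, E.d_smul_cocycle _ (hQ _ j), hn, op_mul_sum_smul]
  have h2 : E.d (∑ i, op (T i j) • m i) = ∑ i, op ((P * Q) i j) • m i := by
    simp only [hT, map_sum, E.d_smul_of_charTwo, hm, smul_zero, zero_add, Matrix.map_apply]
  rw [map_add, h1, h2, ← sub_neg_eq_add, neg_eq_self_of_charTwo_module k, sub_self]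

theorem sum_smul_sub_mem_range [CharP k 2] [Fintype l] {m : ι → M} {n : κ → M} {P : Matrix ι κ A}
    {Q : Matrix κ l A} {R : Matrix l o A} {T : Matrix ι l A} {U : Matrix κ o A}
    (hn : ∀ j, E.d (n j) = ∑ i, op (P i j) • m i) (hU : Q * R = U.map D.d) (j : o) :
    ∑ i, op ((T * R - P * U) i j) • m i -
      ∑ h, op (R h j) • (∑ k, op (Q k h) • n k + ∑ i, op (T i h) • m i) ∈
      LinearMap.range E.d := by
  -- The terms `m T R` cancel, leaving `-(m P U + n Q R) = -d (n U)`.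
  refine ⟨-∑ k, op (U k j) • n k, ?_⟩
  simp only [map_neg, map_sum, E.d_smul_of_charTwo, hn, smul_add, Finset.sum_add_distrib,
    ← op_mul_sum_smul, Matrix.sub_apply, op_sub, sub_smul, Finset.sum_sub_distrib, hU,
    Matrix.map_apply]
  abel

end DGModule

end

/-! ### The main argument. -/

theorem proposition2p14 {k : Type*} {A : Type*} [Field k] [CharP k 2] [Ring A] [Algebra k A]
    {𝒜 : ℤ → Submodule k A} [GradedAlgebra 𝒜] (D : DGAlgebra 𝒜)
    {a b c e : ℕ} (p : Fin a → ℤ) (q : Fin b → ℤ) (r : Fin c → ℤ) (s : Fin e → ℤ)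
    (X : Matrix (Fin a) (Fin b) D.Cohomology) (Y : Matrix (Fin b) (Fin c) D.Cohomology)
    (Z : Matrix (Fin c) (Fin e) D.Cohomology)
    (hX : D.IsGradedMatrix q p X) (hY : D.IsGradedMatrix r q Y) (hZ : D.IsGradedMatrix s r Z)
    (hXY : X * Y = 0) (hYZ : Y * Z = 0)
    (h0 : (0 : Matrix (Fin a) (Fin e) D.Cohomology) ∉ D.matricMassey p q r s X Y Z)
    {M : Type*} [AddCommGroup M] [Module k M] [Module Aᵐᵒᵖ M] [IsScalarTower k Aᵐᵒᵖ M]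
    {ℳ : ℤ → Submodule k M} [DirectSum.Decomposition ℳ] (E : DGModule D ℳ) :
    ¬ D.CokerIsSummand p X E := by
  classical
  rintro ⟨f, g, hf, hg, hgf⟩
  obtain ⟨Xb, hXb⟩ := hX.exists_representsMatrix
  obtain ⟨Yb, hYb⟩ := hY.exists_representsMatrix
  obtain ⟨Zb, hZb⟩ := hZ.exists_representsMatrix
  obtain ⟨T₀, hT₀, hdT₀⟩ := DGAlgebra.exists_matrix_primitive hXb hYb hXY
  obtain ⟨U₀, hU₀, hdU₀⟩ := DGAlgebra.exists_matrix_primitive hYb hZb hYZ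
  set π := (LinearMap.range (D.matrixMap X)).mkQ with hπ
  have hgf' (x) : g (f x) = x := LinearMap.congr_fun hgf x
  choose m hm hmf using fun i => DGModule.represents_of_mem_cohomologyGrading
    (hf (p i) (π (Pi.single i 1)) ⟨_, DGAlgebra.single_one_mem_freeGrading p i, rfl⟩)
  have hn (j) : ∃ n ∈ ℳ (q j - 1), E.d n = ∑ i, MulOpposite.op (Xb i j) • m i := by
    refine E.exists_homogeneous_primitive (E.sum_smul_mem (n' := 0) (p := p) (by simpa using hm)
      (by simpa using fun i => (hXb i j).1)) ?_
    rw [← DGModule.Represents.zero_iff]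
    convert DGAlgebra.represents_map_mkQ f hmf fun i => (hXb i j).2
    -- Column `j` of `X` is the image of the `j`-th basis vector.
    have : (LinearMap.range (D.matrixMap X)).mkQ (fun i => X i j) = 0 := by
      rw [Submodule.mkQ_apply, Submodule.Quotient.mk_eq_zero]
      exact ⟨Pi.single j 1, X.mulVec_single_one j⟩
    rw [this, map_zero]
  choose n hn hdn using hn
  have hdm (i) : E.d (m i) = 0 := (hmf i).d_eq_zero
  have hdY (i j) : D.d (Yb i j) = 0 := (hYb i j).2.d_eq_zero
  have hdZ (i j) : D.d (Zb i j) = 0 := (hZb i j).2.d_eq_zero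
  -- Correct `T₀` so that `n Y + m T` is annihilated by `g`.
  have hV (j) : ∃ v : Fin a → A, (∀ i, v i ∈ 𝒜 (r j - p i - 1)) ∧ (∀ i, D.d (v i) = 0) ∧
      ∃ ω, E.Represents (∑ h, MulOpposite.op (Yb h j) • n h +
        ∑ i, MulOpposite.op (T₀ i j - v i) • m i) ω ∧ g ω = 0 := by
    have hd := E.d_add_sum_smul_eq_zero hdm hdn hdY hdT₀ j
    have hmem : ∑ h, MulOpposite.op (Yb h j) • n h + ∑ i, MulOpposite.op (T₀ i j) • m i ∈
        ℳ (r j - 1) := by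
      refine Submodule.add_mem _ (E.sum_smul_mem hn fun h => ?_)
        (E.sum_smul_mem (n' := 0) (p := p) (by simpa using hm) fun i => ?_)
      · simpa using (hYb h j).1
      · rw [show r j - 1 + 0 - p i = r j - p i - 1 by ring]
        exact hT₀ i j
    -- As `g` preserves degrees, its value lifts to a homogeneous `v`. Subtracting `f (π v)` from
    -- the class leaves an element of `ker g`, because `g (f (π v)) = π v`.
    obtain ⟨v, hv, hvg⟩ := hg (r j - 1) (E.coboundaries.mkQ ⟨_, hd⟩) ⟨⟨_, hd⟩, hmem, rfl⟩
    choose vb hvb hvr using fun i =>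
      DGAlgebra.represents_of_mem_cohomologyGrading (hv i (Set.mem_univ i))
    refine ⟨vb, fun i => ?_, fun i => (hvr i).d_eq_zero,
      E.coboundaries.mkQ ⟨_, hd⟩ - f (π v), ?_, ?_⟩
    · rw [show r j - p i - 1 = r j - 1 - p i by ring]
      exact hvb i
    · have := (show E.Represents _ _ from ⟨⟨_, hd⟩, rfl, rfl⟩).sub
        (DGAlgebra.represents_map_mkQ f hmf hvr)
      convert this using 1
      simp only [MulOpposite.op_sub, sub_smul, Finset.sum_sub_distrib]
      abel
    · rw [map_sub, hgf', ← hvg]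
      exact sub_self _
  choose V hVmem hdV ω hω hgω using hV
  set T : Matrix (Fin a) (Fin c) A := T₀ - (Matrix.of V).transpose with hTdef
  have hT (i j) : T i j ∈ 𝒜 (r j - p i - 1) := Submodule.sub_mem _ (hT₀ i j) (hVmem j i)
  have hdT : Xb * Yb = T.map D.d := by
    rw [hdT₀]
    ext i j
    simp [hTdef, hdV]
  -- The resulting Massey representative lies in the image of `X`.
  have hBd (i j) : D.d ((T * Zb - Xb * U₀) i j) = 0 := by
    have h1 : (T * Zb).map D.d = T.map D.d * Zb := by
      ext i j
      simp [Matrix.mul_apply, DGAlgebra.d_mul_of_charTwo, hdZ]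
    have h2 : (Xb * U₀).map D.d = Xb * U₀.map D.d := by
      ext i j
      simp [Matrix.mul_apply, DGAlgebra.d_mul_of_charTwo, (hXb _ _).2.d_eq_zero]
    rw [Matrix.sub_apply, map_sub, ← Matrix.map_apply (f := D.d) (M := T * Zb),
      ← Matrix.map_apply (f := D.d) (M := Xb * U₀), h1, h2, ← hdT, ← hdU₀, Matrix.mul_assoc,
      sub_self]
  have hW (j) : ∃ w : Fin b → A, (∀ h, w h ∈ 𝒜 (s j - 1 - q h)) ∧ (∀ h, D.d (w h) = 0) ∧
      ∀ i, (T * Zb - Xb * U₀) i j - ∑ h, Xb i h * w h ∈ LinearMap.range D.d := by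
    choose β hβ using fun i => DGAlgebra.exists_represents (hBd i j)
    refine DGAlgebra.exists_homogeneous_preimage hXb (fun i => ?_) hβ ?_
    · refine Submodule.sub_mem _ ?_ ?_
      -- Taking `u = p i + 1` accounts for the lowered degree of `T`.
      · refine DGAlgebra.mul_apply_mem (q := r) (u := p i + 1) (v := s j) (fun h => ?_)
          (fun h => (hZb h j).1) (by ring)
        rw [← sub_sub]
        exact hT i h
      · refine DGAlgebra.mul_apply_mem (v := s j - 1) (fun h => (hXb i h).1) (fun h => ?_) rfl
        rw [sub_right_comm]
        exact hU₀ h j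
    -- It suffices that `g (f (π β)) = 0`: the class `f (π β)` equals `ω Z`, and `g` is linear and
    -- kills `ω`.
    · rw [← Submodule.Quotient.mk_eq_zero, ← Submodule.mkQ_apply, ← hπ, ← hgf' (π β)]
      have : f (π β) = ∑ h, MulOpposite.op (Z h j) • ω h :=
        (DGAlgebra.represents_map_mkQ f hmf hβ).eq_of_sub_mem_range
          (DGModule.Represents.sum _ fun h => (hω h).smul (hZb h j).2)
          (E.sum_smul_sub_mem_range hdn hdU₀ j)
      rw [this, map_sum]
      exact Finset.sum_eq_zero fun h _ => by rw [map_smul, hgω, smul_zero]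
  choose W hWmem hdW hWr using hW
  refine h0 ⟨Xb, Yb, Zb, T, U₀ + (Matrix.of W).transpose, hXb, hYb, hZb, hT, hdT, fun h j => ?_, ?_,
    fun i j => ?_⟩
  · refine Submodule.add_mem _ (hU₀ h j) ?_
    rw [sub_right_comm]
    exact hWmem j h
  · rw [hdU₀]
    ext h j
    simp [hdW]
  · rw [Matrix.zero_apply, DGAlgebra.Represents.zero_iff]
    convert hWr j i using 1
    simp only [Matrix.sub_apply, Matrix.mul_add, Matrix.add_apply, sub_add_eq_sub_sub]
    rfl
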